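/- Let $X$ be a Banach space over $\mathbb K\in\{\mathbb R,\mathbb C\}$ with closed unit ball $B_X$ and dual $X^*$; all Banach spaces below are over $\mathbb K$, "operator" means bounded linear operator, and $\ell_\infty$ is the Banach space of bounded sequences in $\mathbb K$ with the supremum norm. We use the following quantities. For a set $F$ of continuous linear functionals on a Banach space $Z$ put $q_F(z)=\sup_{f\in F}|f(z)|$ (with $\sup\emptyset=0$). For a family $\mathcal F$ of subsets of $B_{Z^*}$ and a bounded sequence $(z_n)$ in $Z$ put $$\mathrm{ca}_{\mathcal F}(z_n)=\sup_{F\in\mathcal F}\ \inf_{N}\ \sup_{m,n\ge N} q_F(z_m-z_n).$$ If $\mathcal F$ consists of all subsets of $B_{Z^*}$, we write $\mathrm{ca}(z_n)$; if it consists of all finite subsets of $B_{Z^*}$, we write $\delta(z_n)$. If $Z=X^*$ and $\mathcal F$ consists of all weakly compact subsets of $B_X$ (embedded canonically in $X^{**}$), we write $\mathrm{ca}_{\rho^*}(z_n)$, and $\widetilde{\mathrm{ca}}_{\rho^*}(z_n)$ denotes the infimum of $\mathrm{ca}_{\rho^*}(z_{k_n})$ over all subsequences $(z_{k_n})$ of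 $(z_n)$. For an operator $T:X\to Y$ put $\mathrm{cc}(T)=\sup\{\mathrm{ca}(Tx_n):(x_n)\text{ a weakly Cauchy sequence in }B_X\}$, and let $T^*:Y^*\to X^*$ be its adjoint. For a bounded subset $A$ of a Banach space $Z$ put $\mathrm{wk}_Z(A)=\sup\{\mathrm{dist}(z^{**},Z): z^{**}\in\overline{A}^{w^*}\}$, where $Z\subset Z^{**}$ canonically and the weak$^*$ closure is taken in $Z^{**}$. For an operator $S:W\to Z$ between Banach spaces put $\mathrm{wk}_Z(S)=\mathrm{wk}_Z(S(B_W))$. Then the following assertions are equivalent: (i) There is $C>0$ such that $\mathrm{cc}(T)\le C\,\mathrm{wk}_{X^*}(T^*)$ for every operator $T$ from $X$ to a Banach space $Y$. (ii) There is $C>0$ such that $\mathrm{cc}(T)\le C\,\mathrm{wk}_{X^*}(T^*)$ for every operator $T$ from $X$ to $\ell_\infty$. (iii) There is $C>0$ such that $\limsup_n|x_n^*(x_n)|\le C\,\mathrm{wk}_{X^*}(\{x_n^*:n\in\mathbb N\})$ whenever $(x_n)$ is a weakly null sequence in $B_X$ and $(x_n^*)$ is a bounded sequence in $X^*$. (iv)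 There is $C>0$ such that $\mathrm{ca}_{\rho^*}(x_n^*)\le C\,\delta(x_n^*)$ for every bounded sequence $(x_n^*)$ in $X^*$. (v) There is $C>0$ such that $\widetilde{\mathrm{ca}}_{\rho^*}(x_n^*)\le C\,\mathrm{wk}_{X^*}(\{x_n^*:n\in\mathbb N\})$ for every bounded sequence $(x_n^*)$ in $X^*$. (vi) There is $C>0$ such that $\mathrm{cc}(T)\le C\,\mathrm{wk}_Y(T)$ for every operator $T$ from $X$ to a Banach space $Y$. (vii) There is $C>0$ such that $\mathrm{cc}(T)\le C\,\mathrm{wk}_{\ell_\infty}(T)$ for every operator $T$ from $X$ to $\ell_\infty$. -/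

import Mathlib

open scoped ENNReal NNReal Topology

universe u v

namespace QuantDP

noncomputable section

/-! All quantities take values in `ℝ≥0∞`, so that suprema and infima need no boundedness
side conditions and the supremum of the empty set is `0`. -/

section Basic

variable (𝕜 : Type) [RCLike 𝕜]
variable {X : Type u} [NormedAddCommGroup X] [NormedSpace 𝕜 X]

/-- The seminorm `q_F(x) = sup {|f(x)| : f ∈ F}` attached to a set `F` of functionals. -/
def qSeminorm (F : Set (StrongDual 𝕜 X)) (x : X) : ℝ≥0∞ :=
  ⨆ f ∈ F, ‖f x‖ₑ

/-- `ca_𝓕(x_n) = sup_{F ∈ 𝓕} inf_N sup_{m, n ≥ N} q_F(x_m - x_n)`: the distance of the sequence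
`(x_n)` from being Cauchy in the topology of uniform convergence on the members of `𝓕`. -/
def caFam (𝓕 : Set (Set (StrongDual 𝕜 X))) (x : ℕ → X) : ℝ≥0∞ :=
  ⨆ F ∈ 𝓕, ⨅ N : ℕ, ⨆ m ≥ N, ⨆ n ≥ N, qSeminorm 𝕜 F (x m - x n)

variable (X) in
/-- All subsets of the dual unit ball (the associated topology is the norm topology). -/
def normFamily : Set (Set (StrongDual 𝕜 X)) :=
  {F | F ⊆ Metric.closedBall 0 1}

variable (X) in
/-- All finite subsets of the dual unit ball (the associated topology is the weak topology). -/
def weakFamily : Set (Set (StrongDual 𝕜 X)) :=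
  {F | F ⊆ Metric.closedBall 0 1 ∧ F.Finite}

/-- A set `K` is weakly compact. -/
def IsWeaklyCompact (K : Set X) : Prop :=
  IsCompact (toWeakSpace 𝕜 X '' K)

variable (X) in
/-- The weakly compact subsets of `B_X`, canonically embedded in the dual of `X*`
(the associated topology on `X*` is the Mackey topology `ρ* = τ(X*, X)`). -/
def rhoStarFamily : Set (Set (StrongDual 𝕜 (StrongDual 𝕜 X))) :=
  {F | ∃ K : Set X, K ⊆ Metric.closedBall 0 1 ∧ IsWeaklyCompact 𝕜 K ∧
    F = NormedSpace.inclusionInDoubleDual 𝕜 X '' K}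

/-- `ca(x_n)`: distance from being norm Cauchy. -/
def ca (x : ℕ → X) : ℝ≥0∞ := caFam 𝕜 (normFamily 𝕜 X) x

/-- `δ(x_n)`: distance from being weakly Cauchy. -/
def deltaSeq (x : ℕ → X) : ℝ≥0∞ := caFam 𝕜 (weakFamily 𝕜 X) x

/-- `ca_{ρ*}(x_n*)`: distance of a sequence in `X*` from being `ρ*`-Cauchy. -/
def caRhoStar (x' : ℕ → StrongDual 𝕜 X) : ℝ≥0∞ := caFam 𝕜 (rhoStarFamily 𝕜 X) x'

/-- The infimum of `ca_{ρ*}` over all subsequences of a sequence in `X*`. -/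
def wcaRhoStar (x' : ℕ → StrongDual 𝕜 X) : ℝ≥0∞ :=
  ⨅ (φ : ℕ → ℕ) (_ : StrictMono φ), caRhoStar 𝕜 (x' ∘ φ)

/-- `(x_n)` is weakly Cauchy. -/
def WeaklyCauchySeq (x : ℕ → X) : Prop :=
  ∀ f : StrongDual 𝕜 X, CauchySeq (fun n => f (x n))

/-- `(x_n)` converges weakly to `0`. -/
def WeaklyNull (x : ℕ → X) : Prop :=
  Filter.Tendsto (fun n => toWeakSpace 𝕜 X (x n)) Filter.atTop (𝓝 0)

/-- The weak* closure in `X**` of a set `A ⊆ X`. -/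
def wsClosure (A : Set X) : Set (StrongDual 𝕜 (StrongDual 𝕜 X)) :=
  {z | StrongDual.toWeakDual z ∈
    closure ((fun a => StrongDual.toWeakDual (NormedSpace.inclusionInDoubleDual 𝕜 X a)) '' A)}

/-- `wk_X(A) = sup {dist(z, X) : z in the weak* closure of A in X**}`. -/
def wk (A : Set X) : ℝ≥0∞ :=
  ⨆ z ∈ wsClosure 𝕜 A, Metric.infEDist z (Set.range (NormedSpace.inclusionInDoubleDual 𝕜 X))

end Basic

section Operators

variable {𝕜 : Type} [RCLike 𝕜]
variable {X : Type u} [NormedAddCommGroup X] [NormedSpace 𝕜 X]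
variable {Y : Type v} [NormedAddCommGroup Y] [NormedSpace 𝕜 Y]

/-- The Banach space adjoint `T* : Y* → X*`, `T*(g) = g ∘ T`. -/
def dualOp (T : X →L[𝕜] Y) : StrongDual 𝕜 Y →L[𝕜] StrongDual 𝕜 X :=
  T.precomp 𝕜

/-- `cc(T) = sup {ca(T x_n) : (x_n) a weakly Cauchy sequence in B_X}`. -/
def cc (T : X →L[𝕜] Y) : ℝ≥0∞ :=
  ⨆ (x : ℕ → X) (_ : ∀ n, x n ∈ Metric.closedBall 0 1) (_ : WeaklyCauchySeq 𝕜 x),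
    ca 𝕜 (fun n => T (x n))

/-- `wk_Y(T) = wk_Y(T(B_X))`. -/
def wkOp (T : X →L[𝕜] Y) : ℝ≥0∞ :=
  wk 𝕜 (T '' Metric.closedBall 0 1)

end Operators

end

end QuantDP

/-! Everything reduces to the sequential Dunford–Pettis inequality `LimsupBound`, the assertion
about weakly null sequences in `X` and bounded sequences in `X*`.

It implies the bounds on `cc T` in terms of `T*` and on `caRhoStar` in terms of `deltaSeq` directly:
one picks pairs of indices witnessing that a sequence is far from being Cauchy, and the differences
form a weakly null sequence, for `caRhoStar` after passing to a weakly convergent subsequence by the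
Eberlein–Šmulian theorem (`LimsupBound.cc_le`, `LimsupBound.caRhoStar_le`).

The measures of weak non-compactness of `T` and `T*` are related by a quantitative Gantmacher
theorem (`wkOp_dualOp_le`), so that the assertions about `T*` imply those about `T`.

The way back rests on a quantitative Eberlein–Šmulian theorem (`exists_subseq_eventually_near`):
every bounded sequence in a normed space has a subsequence which is eventually within a multiple of
`wk` of a fixed point `u`, at each functional separately. It bounds `deltaSeq` of a subsequence by
`wk`, and thereby gives the bound on `wcaRhoStar`, from which `LimsupBound` follows by looking at
the weakly compact set formed by a weakly null sequence and `0`. It also reduces the assertion about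
operators into `ℓ∞` to operators `T x = (z n x)` whose coordinates satisfy, eventually in `n`,
`|F (z n)| ≤ s ‖F‖` for each `F` in the bidual. For `F` in the unit ball of the bidual, `T** F` is
then within `2 s` of the bounded sequence `F (z n)` (`wkOp_le_of_eventually_le`): a functional on
`ℓ∞` splits into a summable part, which sees no difference between the two, and a part depending
only on the behaviour at infinity, which is small on both. No estimate for convex hulls is
needed. -/

namespace QuantDP

open Filter Set

/-! ### Weak* closures, ultrafilters and Goldstine's theorem -/

section WeakStarClosure

variable {𝕜 : Type} [RCLike 𝕜]
variable {W : Type*} [NormedAddCommGroup W] [NormedSpace 𝕜 W]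

/-- To bound `b` by a multiple of `a` it suffices to use real numbers strictly above `a`; the case
`a = ⊤` is where `0 < C` is needed. -/
theorem le_mul_of_forall_real {C : ℝ≥0} (hC : 0 < C) {a b : ℝ≥0∞}
    (h : ∀ r : ℝ, 0 < r → a < ENNReal.ofReal r → b ≤ C * ENNReal.ofReal r) : b ≤ C * a := by
  have hC' : (C : ℝ≥0∞) ≠ 0 := by exact_mod_cast hC.ne'
  rw [← ENNReal.div_le_iff' hC' ENNReal.coe_ne_top]
  refine le_of_forall_gt_imp_ge_of_dense fun c hc => ?_
  rcases eq_or_ne c ⊤ with rfl | hct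
  · exact le_top
  have hc0 : 0 < c.toReal := ENNReal.toReal_pos (ne_bot_of_gt hc) hct
  rw [ENNReal.div_le_iff' hC' ENNReal.coe_ne_top]
  have := h c.toReal hc0 (by rwa [ENNReal.ofReal_toReal hct])
  rwa [ENNReal.ofReal_toReal hct] at this

theorem tendsto_toWeakDual_iff {ι V : Type*} [NormedAddCommGroup V] [NormedSpace 𝕜 V]
    {l : Filter ι} {g : ι → StrongDual 𝕜 V} {z : StrongDual 𝕜 V} :
    Tendsto (fun i => StrongDual.toWeakDual (g i)) l (𝓝 (StrongDual.toWeakDual z)) ↔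
      ∀ v, Tendsto (fun i => g i v) l (𝓝 (z v)) :=
  WeakBilin.tendsto_iff_forall_eval_tendsto _ ContinuousLinearMap.coe_injective

/-- The Banach–Alaoglu theorem in ultrafilter form. -/
theorem exists_dual_limit {ι V : Type*} [NormedAddCommGroup V] [NormedSpace 𝕜 V]
    (U : Ultrafilter ι) (g : ι → StrongDual 𝕜 V) {M : ℝ} (hg : ∀ i, ‖g i‖ ≤ M) :
    ∃ z : StrongDual 𝕜 V, ‖z‖ ≤ M ∧ ∀ v, Tendsto (fun i => g i v) U (𝓝 (z v)) := by
  have hK := WeakDual.isCompact_closedBall (𝕜 := 𝕜) (0 : StrongDual 𝕜 V) M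
  obtain ⟨z, hz, hle⟩ := hK.ultrafilter_le_nhds (U.map fun i => StrongDual.toWeakDual (g i)) (by
    simp only [Ultrafilter.coe_map, le_principal_iff, Filter.mem_map]
    refine Filter.univ_mem' fun i => ?_
    simpa using hg i)
  refine ⟨WeakDual.toStrongDual z, by simpa using hz, fun v => ?_⟩
  have h2 : Tendsto (fun i => StrongDual.toWeakDual (g i)) U
      (𝓝 (StrongDual.toWeakDual (WeakDual.toStrongDual z))) := hle
  exact tendsto_toWeakDual_iff.1 h2 v

/-- The ultrafilter lives on the index type rather than on the bidual, so that limits of several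
quantities attached to the same index can be compared. -/
theorem mem_wsClosure_range_iff {ι : Type*} (g : ι → W) (z : StrongDual 𝕜 (StrongDual 𝕜 W)) :
    z ∈ wsClosure 𝕜 (range g) ↔
      ∃ U : Ultrafilter ι, ∀ f : StrongDual 𝕜 W, Tendsto (fun i => f (g i)) U (𝓝 (z f)) := by
  have key : ∀ l : Filter ι, Tendsto (fun i => StrongDual.toWeakDual
      (NormedSpace.inclusionInDoubleDual 𝕜 W (g i))) l (𝓝 (StrongDual.toWeakDual z)) ↔
      ∀ f : StrongDual 𝕜 W, Tendsto (fun i => f (g i)) l (𝓝 (z f)) :=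
    fun l => tendsto_toWeakDual_iff
  simp only [← key]
  set J : ι → WeakDual 𝕜 (StrongDual 𝕜 W) := fun i => StrongDual.toWeakDual
    (NormedSpace.inclusionInDoubleDual 𝕜 W (g i))
  have hmem : z ∈ wsClosure 𝕜 (range g) ↔ StrongDual.toWeakDual z ∈ closure (range J) := by
    rw [wsClosure, mem_ofPred_eq, ← range_comp]
    rfl
  rw [hmem, mem_closure_iff_ultrafilter]
  constructor
  · rintro ⟨U, hU, hle⟩
    have : (comap J U).NeBot := comap_neBot_iff_frequently.2 (Eventually.frequently hU)
    refine ⟨Ultrafilter.of (comap J U), ?_⟩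
    exact (tendsto_comap.mono_left (Ultrafilter.of_le _)).mono_right hle
  · rintro ⟨U, hU⟩
    exact ⟨U.map J, Filter.mem_of_superset (image_mem_map univ_mem) (by simp), hU⟩

theorem wsClosure_mono {A B : Set W} (h : A ⊆ B) : wsClosure 𝕜 A ⊆ wsClosure 𝕜 B :=
  fun _ hz => closure_mono (X := WeakDual 𝕜 (StrongDual 𝕜 W)) (image_mono h) hz

theorem wk_mono {A B : Set W} (h : A ⊆ B) : wk 𝕜 A ≤ wk 𝕜 B :=
  biSup_mono fun _ hz => wsClosure_mono h hz

theorem exists_norm_sub_lt_of_wk_lt {A : Set W} {r : ℝ} (h : wk 𝕜 A < ENNReal.ofReal r)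
    {z : StrongDual 𝕜 (StrongDual 𝕜 W)} (hz : z ∈ wsClosure 𝕜 A) :
    ∃ w : W, ‖z - NormedSpace.inclusionInDoubleDual 𝕜 W w‖ < r := by
  have h1 : Metric.infEDist z (Set.range (NormedSpace.inclusionInDoubleDual 𝕜 W))
      < ENNReal.ofReal r := lt_of_le_of_lt (le_iSup₂ (f := fun z _ => Metric.infEDist z
        (Set.range (NormedSpace.inclusionInDoubleDual 𝕜 W))) z hz) h
  obtain ⟨_, ⟨w, rfl⟩, hw⟩ := Metric.infEDist_lt_iff.1 h1
  refine ⟨w, ?_⟩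
  rw [edist_dist, dist_eq_norm] at hw
  exact lt_of_not_ge fun hle => hw.not_ge (ENNReal.ofReal_le_ofReal hle)

theorem wk_le_ofReal {A : Set W} {r : ℝ}
    (h : ∀ z ∈ wsClosure 𝕜 A, ∃ w : W, ‖z - NormedSpace.inclusionInDoubleDual 𝕜 W w‖ ≤ r) :
    wk 𝕜 A ≤ ENNReal.ofReal r := by
  refine iSup₂_le fun z hz => ?_
  obtain ⟨w, hw⟩ := h z hz
  refine (Metric.infEDist_le_edist_of_mem (mem_range_self w)).trans ?_
  rw [edist_dist, dist_eq_norm]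
  exact ENNReal.ofReal_le_ofReal hw

/-- Hahn–Banach separation in the weak* topology, where every continuous functional is an
evaluation. Convexity is stated with scalars in `𝕜`, so that no real structure on the weak
dual is involved. -/
theorem exists_eval_separating {V : Type*} [NormedAddCommGroup V] [NormedSpace 𝕜 V]
    {s : Set (WeakDual 𝕜 V)} (hc : IsClosed s)
    (hs : ∀ x ∈ s, ∀ y ∈ s, ∀ a b : ℝ, 0 ≤ a → 0 ≤ b → a + b = 1 → (a : 𝕜) • x + (b : 𝕜) • y ∈ s)
    {F : WeakDual 𝕜 V} (hF : F ∉ s) :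
    ∃ (v : V) (c : ℝ), (∀ a ∈ s, RCLike.re (a v) < c) ∧ c < RCLike.re (F v) := by
  have i1 : LocallyConvexSpace ℝ (WeakDual 𝕜 V) :=
    (WeakDual.withSeminorms 𝕜 V).toLocallyConvexSpace
  have i2 : IsScalarTower ℝ 𝕜 (WeakDual 𝕜 V) :=
    ⟨fun a b f => DFunLike.ext _ _ fun v => smul_assoc a b (f v)⟩
  have key : ∃ (l : StrongDual 𝕜 (WeakDual 𝕜 V)) (c : ℝ),
      (∀ a ∈ s, RCLike.re (l a) < c) ∧ c < RCLike.re (l F) := by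
    refine RCLike.geometric_hahn_banach_closed_point (𝕜 := 𝕜) (E := WeakDual 𝕜 V) ?_ hc hF
    intro x hx y hy a b ha hb hab
    have := hs x hx y hy a b ha hb hab
    rw [← algebraMap_smul 𝕜 a x, ← algebraMap_smul 𝕜 b y]
    exact this
  obtain ⟨l, c, hls, hl⟩ := key
  have : ∃ v, ∀ a, l a = a v := by
    obtain ⟨v, hv⟩ := LinearMap.dualEmbedding_surjective (topDualPairing 𝕜 V) l
    exact ⟨v, fun a => by rw [← hv]; rfl⟩
  obtain ⟨v, hv⟩ := this
  simp only [hv] at hls hl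
  exact ⟨v, c, hls, hl⟩

/-- Goldstine's theorem: the unit ball is weak* dense in the unit ball of the bidual. -/
theorem goldstine (F : StrongDual 𝕜 (StrongDual 𝕜 W)) (hF : ‖F‖ ≤ 1) :
    F ∈ wsClosure 𝕜 (Metric.closedBall (0 : W) 1) := by
  set S : Set (WeakDual 𝕜 (StrongDual 𝕜 W)) := (fun a => StrongDual.toWeakDual
    (NormedSpace.inclusionInDoubleDual 𝕜 W a)) '' Metric.closedBall (0 : W) 1
  by_contra hne
  have hne' : StrongDual.toWeakDual F ∉ closure S := hne
  obtain ⟨f, s, hls, hl⟩ := exists_eval_separating isClosed_closure (by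
    intro x hx y hy a b ha hb hab
    have hcont : Continuous (Function.uncurry fun x y : WeakDual 𝕜 (StrongDual 𝕜 W) =>
        (a : 𝕜) • x + (b : 𝕜) • y) := by
      change Continuous fun p : WeakDual 𝕜 (StrongDual 𝕜 W) × WeakDual 𝕜 (StrongDual 𝕜 W) =>
        (a : 𝕜) • p.1 + (b : 𝕜) • p.2
      exact (continuous_fst.const_smul (a : 𝕜)).add (continuous_snd.const_smul (b : 𝕜))
    refine map_mem_closure₂ (f := fun x y : WeakDual 𝕜 (StrongDual 𝕜 W) =>
      (a : 𝕜) • x + (b : 𝕜) • y) hcont hx hy ?_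
    rintro _ ⟨v, hv, rfl⟩ _ ⟨w, hw, rfl⟩
    refine ⟨(a : 𝕜) • v + (b : 𝕜) • w, ?_, by simp⟩
    have hv : ‖v‖ ≤ 1 := by simpa using hv
    have hw : ‖w‖ ≤ 1 := by simpa using hw
    have := norm_add_le ((a : 𝕜) • v) ((b : 𝕜) • w)
    simp only [norm_smul, RCLike.norm_ofReal, abs_of_nonneg ha, abs_of_nonneg hb] at this
    simp only [Metric.mem_closedBall, dist_zero_right]
    nlinarith) hne'
  change s < RCLike.re (F f) at hl
  have hls' : ∀ w : W, ‖w‖ ≤ 1 → RCLike.re (f w) < s := fun w hw =>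
    hls _ (subset_closure ⟨w, by simpa using hw, rfl⟩)
  have hs0 : 0 < s := by simpa using hls' 0 (by simp)
  have hfs : ‖f‖ ≤ s := by
    refine f.opNorm_le_of_unit_norm hs0.le fun w hw => ?_
    obtain ⟨c, hc, hcw⟩ := RCLike.exists_norm_eq_mul_self (f w)
    have := hls' (c • w) (by rw [norm_smul, hc, hw, one_mul])
    rw [map_smul, smul_eq_mul, ← hcw, RCLike.ofReal_re] at this
    exact this.le
  have h1 : RCLike.re (F f) ≤ ‖F‖ * ‖f‖ := (RCLike.re_le_norm _).trans (F.le_opNorm f)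
  nlinarith [norm_nonneg f]

end WeakStarClosure

/-! ### Almost weakly convergent subsequences -/

section Subsequences

variable {𝕜 : Type} [RCLike 𝕜]
variable {W : Type*} [NormedAddCommGroup W] [NormedSpace 𝕜 W]

theorem tendsto_toWeakSpace_iff {ι : Type*} {l : Filter ι} {x : ι → W} {u : W} :
    Tendsto (fun i => toWeakSpace 𝕜 W (x i)) l (𝓝 (toWeakSpace 𝕜 W u)) ↔
      ∀ f : StrongDual 𝕜 W, Tendsto (fun i => f (x i)) l (𝓝 (f u)) := by
  refine WeakBilin.tendsto_iff_forall_eval_tendsto (topDualPairing 𝕜 W).flip ?_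
  intro a b hab
  refine (SeparatingDual.eq_iff_forall_dual_eq (R := 𝕜)).2 fun f => ?_
  exact congrArg (fun g : StrongDual 𝕜 W →ₗ[𝕜] 𝕜 => g f) hab

theorem weaklyNull_iff {x : ℕ → W} :
    WeaklyNull 𝕜 x ↔ ∀ f : StrongDual 𝕜 W, Tendsto (fun n => f (x n)) atTop (𝓝 0) := by
  have := tendsto_toWeakSpace_iff (𝕜 := 𝕜) (l := atTop) (x := x) (u := 0)
  simp only [map_zero] at this
  exact this

/-- If a weak* limit of elements `w i` of a space is within `r` of the point `u`, then `u` is almost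
within `r` of the closed span of the `w i`: test against a functional that vanishes on this span
and norms the class of `u` in the quotient. -/
theorem exists_mem_closure_span_near {ι : Type*} {w : ι → W} {U : Ultrafilter ι}
    {z : StrongDual 𝕜 (StrongDual 𝕜 W)}
    (hz : ∀ f : StrongDual 𝕜 W, Tendsto (fun i => f (w i)) U (𝓝 (z f))) {u : W} {r : ℝ}
    (hu : ‖z - NormedSpace.inclusionInDoubleDual 𝕜 W u‖ ≤ r) {ε : ℝ} (hε : 0 < ε) :
    ∃ v ∈ (Submodule.span 𝕜 (range w)).topologicalClosure, ‖u - v‖ ≤ r + ε := by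
  set Z := (Submodule.span 𝕜 (range w)).topologicalClosure
  have : IsClosed (Z : Set W) := Submodule.isClosed_topologicalClosure _
  obtain ⟨g, hg1, hg⟩ := exists_dual_vector'' 𝕜 (Z.mkQ u)
  let f : StrongDual 𝕜 W := g.comp Z.mkQL
  have hf : ‖f‖ ≤ 1 := by
    refine f.opNorm_le_bound zero_le_one fun x => ?_
    calc ‖g (Z.mkQ x)‖ ≤ 1 * ‖Z.mkQ x‖ := g.le_of_opNorm_le hg1 _
      _ ≤ 1 * ‖x‖ := by gcongr; exact Submodule.Quotient.norm_mk_le Z x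
  have hfw : ∀ i, f (w i) = 0 := fun i => by
    have : Z.mkQ (w i) = 0 := by
      rw [Submodule.mkQ_apply, Submodule.Quotient.mk_eq_zero]
      exact Submodule.le_topologicalClosure _ (Submodule.subset_span (mem_range_self i))
    change g (Z.mkQ (w i)) = 0
    rw [this, map_zero]
  have hzf : z f = 0 := by
    refine tendsto_nhds_unique (hz f) ?_
    simp only [hfw]
    exact tendsto_const_nhds
  have hr : ‖Z.mkQ u‖ ≤ r := by
    have h1 := (z - NormedSpace.inclusionInDoubleDual 𝕜 W u).le_opNorm f
    have h2 : (z - NormedSpace.inclusionInDoubleDual 𝕜 W u) f = -((‖Z.mkQ u‖ : ℝ) : 𝕜) := by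
      rw [← hg]
      simp [hzf, f]
    rw [h2, norm_neg, RCLike.norm_ofReal, abs_of_nonneg (norm_nonneg _)] at h1
    have h3 := norm_nonneg (z - NormedSpace.inclusionInDoubleDual 𝕜 W u)
    have h4 := norm_nonneg f
    nlinarith
  obtain ⟨m, hm, hmr⟩ := Submodule.Quotient.norm_mk_lt (S := Z) (Z.mkQ u) hε
  refine ⟨u - m, ?_, ?_⟩
  · rw [← Submodule.Quotient.mk_eq_zero, Submodule.Quotient.mk_sub, hm]
    simp
  · rw [sub_sub_cancel]
    linarith

/-- The quantitative form of Whitley's proof of the Eberlein–Šmulian theorem. A diagonal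
subsequence is chosen to converge on a countable set `d i` of functionals norming the span of the
sequence. Two weak* cluster points of it agree on every `d i`, so points of the space that are close
to them are close to each other: at most `2 * r` apart at each `d i`, plus `2 * r` for moving both
points into the span and `2 * r` for moving them back. The subsequence does not depend on
`r`, so `r` may tend to `0`. -/
theorem exists_subseq_clusterPts_near {w : ℕ → W} {M : ℝ} (hw : ∀ n, ‖w n‖ ≤ M) :
    ∃ φ : ℕ → ℕ, StrictMono φ ∧ ∀ (U₀ U₁ : Ultrafilter ℕ), (U₀ : Filter ℕ) ≤ atTop →
      (U₁ : Filter ℕ) ≤ atTop → ∀ z₀ z₁ : StrongDual 𝕜 (StrongDual 𝕜 W),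
      (∀ f : StrongDual 𝕜 W, Tendsto (fun n => f (w (φ n))) U₀ (𝓝 (z₀ f))) →
      (∀ f : StrongDual 𝕜 W, Tendsto (fun n => f (w (φ n))) U₁ (𝓝 (z₁ f))) →
      ∀ (u₀ u₁ : W) (r : ℝ), 0 < r → ‖z₀ - NormedSpace.inclusionInDoubleDual 𝕜 W u₀‖ ≤ r →
      ‖z₁ - NormedSpace.inclusionInDoubleDual 𝕜 W u₁‖ ≤ r → ‖u₀ - u₁‖ ≤ 7 * r := by
  obtain ⟨c, hc, hZc⟩ : TopologicalSpace.IsSeparable (Submodule.span 𝕜 (range w) : Set W) :=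
    (countable_range w).isSeparable.span
  have hcne : c.Nonempty := by
    rw [← closure_nonempty_iff]
    exact ⟨0, hZc (Submodule.zero_mem _)⟩
  obtain ⟨s, rfl⟩ := hc.exists_eq_range hcne
  -- The functionals `d i` norm a set that is dense in the span.
  choose d hd1 hds using fun i => exists_dual_vector'' 𝕜 (s i)
  obtain ⟨a, -, φ, hφ, ha⟩ :=
    (isCompact_univ_pi fun _ : ℕ => isCompact_closedBall (0 : 𝕜) M).tendsto_subseq
    (x := fun n i => d i (w n)) (fun n i _ => by
      rw [mem_closedBall_zero_iff]
      exact ((d i).le_of_opNorm_le_of_le (hd1 i) (hw n)).trans (one_mul M).le)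
  rw [tendsto_pi_nhds] at ha
  refine ⟨φ, hφ, fun U₀ U₁ hU₀ hU₁ z₀ z₁ hz₀ hz₁ u₀ u₁ r hr h₀ h₁ => ?_⟩
  have e₀ : ∀ i, z₀ (d i) = a i := fun i => tendsto_nhds_unique (hz₀ _) ((ha i).mono_left hU₀)
  have e₁ : ∀ i, z₁ (d i) = a i := fun i => tendsto_nhds_unique (hz₁ _) ((ha i).mono_left hU₁)
  have hsub : range (fun n => w (φ n)) ⊆ range w := range_comp_subset_range φ w
  have hε : 0 < r / 6 := by positivity
  obtain ⟨v₀, hv₀, hv₀r⟩ := exists_mem_closure_span_near hz₀ h₀ hε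
  obtain ⟨v₁, hv₁, hv₁r⟩ := exists_mem_closure_span_near hz₁ h₁ hε
  have hmono := Submodule.topologicalClosure_mono (Submodule.span_mono (R := 𝕜) hsub)
  have hv : v₀ - v₁ ∈ closure (range s) :=
    closure_minimal hZc isClosed_closure (Submodule.sub_mem _ (hmono hv₀) (hmono hv₁))
  obtain ⟨_, ⟨i, rfl⟩, hi⟩ := Metric.mem_closure_iff.1 hv (r / 6) hε
  rw [dist_eq_norm] at hi
  have b₀ : ‖z₀ (d i) - d i u₀‖ ≤ r := by
    simpa using (z₀ - NormedSpace.inclusionInDoubleDual 𝕜 W u₀).le_of_opNorm_le_of_le h₀ (hd1 i)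
  have b₁ : ‖z₁ (d i) - d i u₁‖ ≤ r := by
    simpa using (z₁ - NormedSpace.inclusionInDoubleDual 𝕜 W u₁).le_of_opNorm_le_of_le h₁ (hd1 i)
  rw [e₀] at b₀
  rw [e₁] at b₁
  have bd : ∀ x : W, ‖d i x‖ ≤ ‖x‖ := fun x => by
    simpa using (d i).le_of_opNorm_le (hd1 i) x
  have hsi : ‖s i‖ = ‖d i (s i)‖ := by
    rw [hds, RCLike.norm_ofReal, abs_of_nonneg (norm_nonneg _)]
  have key : d i (s i) = (a i - d i u₁) - (a i - d i u₀) - d i (u₀ - v₀) + d i (u₁ - v₁)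
      - d i (v₀ - v₁ - s i) := by
    simp only [map_sub]; ring
  have hsn : ‖s i‖ ≤ r + r + (r + r / 6) + (r + r / 6) + r / 6 := by
    rw [hsi, key]
    refine (norm_sub_le _ _).trans (add_le_add ((norm_add_le _ _).trans (add_le_add
      ((norm_sub_le _ _).trans (add_le_add ((norm_sub_le _ _).trans (add_le_add b₁ b₀)) ?_)) ?_))
      ?_)
    · exact (bd _).trans hv₀r
    · exact (bd _).trans hv₁r
    · exact (bd _).trans hi.le
  have key2 : u₀ - u₁ = (u₀ - v₀) - (u₁ - v₁) + (v₀ - v₁ - s i) + s i := by abel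
  have : ‖u₀ - u₁‖ ≤ (r + r / 6) + (r + r / 6) + r / 6 + ‖s i‖ := by
    rw [key2]
    exact (norm_add_le _ _).trans (add_le_add ((norm_add_le _ _).trans (add_le_add
      ((norm_sub_le _ _).trans (add_le_add hv₀r hv₁r)) hi.le)) le_rfl)
  linarith

/-- A bounded sequence has a subsequence that is weakly convergent up to a multiple of the measure
of weak non-compactness of its range. The index from which the bound holds depends on `f`. -/
theorem exists_subseq_eventually_near {w : ℕ → W} {M : ℝ} (hw : ∀ n, ‖w n‖ ≤ M) {r : ℝ}
    (hr : 0 < r) (hwk : wk 𝕜 (range w) < ENNReal.ofReal r) :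
    ∃ φ : ℕ → ℕ, StrictMono φ ∧ ∃ u : W, ∀ f : StrongDual 𝕜 W,
      ∀ᶠ n in atTop, ‖f (w (φ n) - u)‖ ≤ 9 * r * ‖f‖ := by
  obtain ⟨φ, hφ, hcl⟩ := exists_subseq_clusterPts_near (𝕜 := 𝕜) hw
  have hlim : ∀ U : Ultrafilter ℕ, ∃ z : StrongDual 𝕜 (StrongDual 𝕜 W), ∃ u : W,
      (∀ f : StrongDual 𝕜 W, Tendsto (fun n => f (w (φ n))) U (𝓝 (z f))) ∧
      ‖z - NormedSpace.inclusionInDoubleDual 𝕜 W u‖ ≤ r := fun U => by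
    obtain ⟨z, -, hz⟩ := exists_dual_limit (𝕜 := 𝕜) U
      (fun n => NormedSpace.inclusionInDoubleDual 𝕜 W (w (φ n))) (M := M)
      fun n => (NormedSpace.double_dual_bound 𝕜 W _).trans (hw _)
    have hz' : z ∈ wsClosure 𝕜 (range w) :=
      wsClosure_mono (range_comp_subset_range φ w) ((mem_wsClosure_range_iff _ z).2 ⟨U, hz⟩)
    obtain ⟨u, hu⟩ := exists_norm_sub_lt_of_wk_lt hwk hz'
    exact ⟨z, u, hz, hu.le⟩
  obtain ⟨z₀, u₀, hz₀, hu₀⟩ := hlim (hyperfilter ℕ)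
  refine ⟨φ, hφ, u₀, fun f => ?_⟩
  by_contra hne
  rw [not_eventually] at hne
  simp only [not_le] at hne
  have : (atTop ⊓ 𝓟 {n | 9 * r * ‖f‖ < ‖f (w (φ n) - u₀)‖}).NeBot := by
    rwa [← frequently_mem_iff_neBot]
  set U := Ultrafilter.of (atTop ⊓ 𝓟 {n | 9 * r * ‖f‖ < ‖f (w (φ n) - u₀)‖})
  have hUle := Ultrafilter.of_le (atTop ⊓ 𝓟 {n | 9 * r * ‖f‖ < ‖f (w (φ n) - u₀)‖})
  obtain ⟨z₁, u₁, hz₁, hu₁⟩ := hlim U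
  have h7 := hcl _ _ Nat.hyperfilter_le_atTop (hUle.trans inf_le_left) z₀ z₁ hz₀ hz₁ u₀ u₁ r hr
    hu₀ hu₁
  have hlimf : Tendsto (fun n => ‖f (w (φ n) - u₀)‖) U (𝓝 ‖z₁ f - f u₀‖) := by
    simp only [map_sub]
    exact ((hz₁ f).sub_const _).norm
  have hge : 9 * r * ‖f‖ ≤ ‖z₁ f - f u₀‖ := by
    refine ge_of_tendsto hlimf ?_
    filter_upwards [(hUle.trans inf_le_right) (mem_principal_self _)] with n hn
    exact le_of_lt hn
  -- The bound `8 * r` here is strictly below `9 * r` unless `f = 0`.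
  have hle : ‖z₁ f - f u₀‖ ≤ r * ‖f‖ + 7 * r * ‖f‖ := by
    have e : z₁ f - f u₀ = (z₁ f - f u₁) - f (u₀ - u₁) := by rw [map_sub]; ring
    rw [e]
    refine (norm_sub_le _ _).trans (add_le_add ?_ ?_)
    · exact (z₁ - NormedSpace.inclusionInDoubleDual 𝕜 W u₁).le_of_opNorm_le hu₁ f
    · rw [mul_comm (7 * r)]
      exact f.le_of_opNorm_le_of_le le_rfl h7
  have hf0 : ‖f‖ = 0 := by
    have := norm_nonneg f
    nlinarith
  obtain ⟨n, hn⟩ := hne.exists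
  rw [norm_eq_zero.1 hf0] at hn
  simp at hn

/-- The Eberlein–Šmulian theorem: bounded weakly compact sets are weakly sequentially compact. -/
theorem IsWeaklyCompact.exists_subseq {K : Set W} (hK : IsWeaklyCompact 𝕜 K) {M : ℝ}
    (hKM : ∀ x ∈ K, ‖x‖ ≤ M) {x : ℕ → W} (hx : ∀ n, x n ∈ K) :
    ∃ φ : ℕ → ℕ, StrictMono φ ∧ ∃ u ∈ K, ∀ f : StrongDual 𝕜 W,
      Tendsto (fun n => f (x (φ n))) atTop (𝓝 (f u)) := by
  obtain ⟨φ, hφ, hcl⟩ := exists_subseq_clusterPts_near (𝕜 := 𝕜) fun n => hKM _ (hx n)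
  have hlim : ∀ U : Ultrafilter ℕ, ∃ u ∈ K, ∀ f : StrongDual 𝕜 W,
      Tendsto (fun n => f (x (φ n))) U (𝓝 (f u)) := fun U => by
    obtain ⟨_, ⟨u, hu, rfl⟩, hle⟩ := IsCompact.ultrafilter_le_nhds hK
      (U.map fun n => toWeakSpace 𝕜 W (x (φ n))) (by
        simp only [Ultrafilter.coe_map, le_principal_iff, Filter.mem_map]
        exact Filter.univ_mem' fun n => ⟨_, hx _, rfl⟩)
    exact ⟨u, hu, tendsto_toWeakSpace_iff.1 hle⟩
  obtain ⟨u₀, hu₀, hz₀⟩ := hlim (hyperfilter ℕ)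
  refine ⟨φ, hφ, u₀, hu₀, fun f => ?_⟩
  rw [tendsto_iff_ultrafilter]
  intro U hU
  obtain ⟨u₁, -, hz₁⟩ := hlim U
  have heq : ‖u₀ - u₁‖ ≤ 0 := by
    refine le_of_forall_pos_le_add fun ε hε => ?_
    have h0 : ∀ u : W, ‖NormedSpace.inclusionInDoubleDual 𝕜 W u -
        NormedSpace.inclusionInDoubleDual 𝕜 W u‖ ≤ ε / 7 := fun u =>
      ContinuousLinearMap.opNorm_le_bound _ (by positivity) fun f => by
        rw [sub_apply, sub_self, norm_zero]
        positivity
    have := hcl _ _ Nat.hyperfilter_le_atTop hU (NormedSpace.inclusionInDoubleDual 𝕜 W u₀)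
      (NormedSpace.inclusionInDoubleDual 𝕜 W u₁) hz₀ hz₁ u₀ u₁ (ε / 7) (by positivity)
      (h0 u₀) (h0 u₁)
    linarith
  rw [sub_eq_zero.1 (norm_le_zero_iff.1 heq)]
  exact hz₁ f

end Subsequences

/-! ### Oscillation of a sequence -/

section Oscillation

variable {𝕜 : Type} [RCLike 𝕜]
variable {W : Type*} [NormedAddCommGroup W] [NormedSpace 𝕜 W]

variable (𝕜) in
/-- The oscillation at infinity of the sequence `x` in the seminorm `q_F`; by definition
`caFam 𝕜 𝓕 x` is the supremum of `osc 𝕜 F x` over `F ∈ 𝓕`. -/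
noncomputable def osc (F : Set (StrongDual 𝕜 W)) (x : ℕ → W) : ℝ≥0∞ :=
  ⨅ N : ℕ, ⨆ m ≥ N, ⨆ n ≥ N, qSeminorm 𝕜 F (x m - x n)

theorem osc_le_caFam {𝓕 : Set (Set (StrongDual 𝕜 W))} {F : Set (StrongDual 𝕜 W)} (hF : F ∈ 𝓕)
    (x : ℕ → W) : osc 𝕜 F x ≤ caFam 𝕜 𝓕 x :=
  le_iSup₂ (f := fun F _ => osc 𝕜 F x) F hF

theorem exists_of_lt_osc {F : Set (StrongDual 𝕜 W)} {x : ℕ → W} {c : ℝ}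
    (h : ENNReal.ofReal c < osc 𝕜 F x) (N : ℕ) :
    ∃ m ≥ N, ∃ n ≥ N, ∃ f ∈ F, c < ‖f (x m - x n)‖ := by
  have h1 := h.trans_le (iInf_le _ N)
  simp only [qSeminorm, lt_iSup_iff] at h1
  obtain ⟨m, hm, n, hn, f, hf, hlt⟩ := h1
  rw [← ofReal_norm] at hlt
  exact ⟨m, hm, n, hn, f, hf, lt_of_not_ge fun hle => hlt.not_ge (ENNReal.ofReal_le_ofReal hle)⟩

theorem exists_forall_of_osc_lt {F : Set (StrongDual 𝕜 W)} {x : ℕ → W} {c : ℝ}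
    (h : osc 𝕜 F x < ENNReal.ofReal c) :
    ∃ N, ∀ m ≥ N, ∀ n ≥ N, ∀ f ∈ F, ‖f (x m - x n)‖ < c := by
  obtain ⟨N, hN⟩ := iInf_lt_iff.1 h
  refine ⟨N, fun m hm n hn f hf => ?_⟩
  have : ENNReal.ofReal ‖f (x m - x n)‖ ≤
      ⨆ m ≥ N, ⨆ n ≥ N, qSeminorm 𝕜 F (x m - x n) := by
    rw [ofReal_norm]
    exact le_iSup₂_of_le m hm (le_iSup₂_of_le n hn
      (le_iSup₂ (f := fun f (_ : f ∈ F) => ‖f (x m - x n)‖ₑ) f hf))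
  exact lt_of_not_ge fun hle => (this.trans_lt hN).not_ge (ENNReal.ofReal_le_ofReal hle)

theorem le_osc {F : Set (StrongDual 𝕜 W)} {x : ℕ → W} {c : ℝ}
    (h : ∀ N, ∃ m ≥ N, ∃ n ≥ N, ∃ f ∈ F, c ≤ ‖f (x m - x n)‖) :
    ENNReal.ofReal c ≤ osc 𝕜 F x := by
  refine le_iInf fun N => ?_
  obtain ⟨m, hm, n, hn, f, hf, hle⟩ := h N
  refine le_iSup₂_of_le m hm (le_iSup₂_of_le n hn (le_iSup₂_of_le f hf ?_))
  rw [← ofReal_norm]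
  exact ENNReal.ofReal_le_ofReal hle

theorem osc_le {F : Set (StrongDual 𝕜 W)} {x : ℕ → W} {c : ℝ}
    (h : ∃ N, ∀ m ≥ N, ∀ n ≥ N, ∀ f ∈ F, ‖f (x m - x n)‖ ≤ c) :
    osc 𝕜 F x ≤ ENNReal.ofReal c := by
  obtain ⟨N, hN⟩ := h
  refine iInf_le_of_le N (iSup₂_le fun m hm => iSup₂_le fun n hn => iSup₂_le fun f hf => ?_)
  rw [← ofReal_norm]
  exact ENNReal.ofReal_le_ofReal (hN m hm n hn f hf)

end Oscillation

/-! ### Adjoints and isometries -/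

section Operators

variable {𝕜 : Type} [RCLike 𝕜]
variable {X : Type u} [NormedAddCommGroup X] [NormedSpace 𝕜 X]
variable {Y : Type*} [NormedAddCommGroup Y] [NormedSpace 𝕜 Y]

theorem dualOp_apply (T : X →L[𝕜] Y) (g : StrongDual 𝕜 Y) (x : X) : dualOp T g x = g (T x) := rfl

theorem mem_wsClosure_image_iff (T : X →L[𝕜] Y) (B : Set X) (z : StrongDual 𝕜 (StrongDual 𝕜 Y)) :
    z ∈ wsClosure 𝕜 (T '' B) ↔
      ∃ U : Ultrafilter B, ∀ f : StrongDual 𝕜 Y, Tendsto (fun b : B => f (T b)) U (𝓝 (z f)) := by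
  rw [image_eq_range, mem_wsClosure_range_iff]

/-- The quantitative Gantmacher theorem. Given a weak* limit `z` of functionals `T* g` with
`‖g‖ ≤ 1`, the element of `X*` close to it is `T* g₀`, where `g₀` is the weak* limit of the `g` in
`Y*`: each `T** F` is close to some `y ∈ Y`, and `g y` tends to `g₀ y`. -/
theorem wkOp_dualOp_le (T : X →L[𝕜] Y) : wkOp (dualOp T) ≤ 2 * wkOp T := by
  refine le_mul_of_forall_real (C := 2) two_pos fun r hr hlt => ?_
  have h2 : ((2 : ℝ≥0) : ℝ≥0∞) * ENNReal.ofReal r = ENNReal.ofReal (2 * r) := by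
    rw [ENNReal.ofReal_mul two_pos.le]; simp
  rw [h2]
  refine wk_le_ofReal fun z hz => ?_
  obtain ⟨U, hU⟩ := (mem_wsClosure_image_iff _ _ z).1 hz
  obtain ⟨g₀, hg₀1, hg₀⟩ := exists_dual_limit (𝕜 := 𝕜) U
    (fun g => (g : StrongDual 𝕜 Y)) (M := 1) (fun g => mem_closedBall_zero_iff.1 g.2)
  refine ⟨dualOp T g₀, ?_⟩
  refine ContinuousLinearMap.opNorm_le_of_unit_norm (by positivity) fun F hF => ?_
  have hTF : F.comp (dualOp T) ∈ wsClosure 𝕜 (T '' Metric.closedBall 0 1) := by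
    obtain ⟨V, hV⟩ := (mem_wsClosure_image_iff (ContinuousLinearMap.id 𝕜 X)
      (Metric.closedBall 0 1) F).1 (by simpa using goldstine F hF.le)
    exact (mem_wsClosure_image_iff _ _ _).2 ⟨V, fun f => hV (dualOp T f)⟩
  obtain ⟨y, hy⟩ := exists_norm_sub_lt_of_wk_lt hlt hTF
  have hb : ∀ g : StrongDual 𝕜 Y, ‖g‖ ≤ 1 → ‖F (dualOp T g) - g y‖ ≤ r := fun g hg => by
    simpa using (F.comp (dualOp T) - NormedSpace.inclusionInDoubleDual 𝕜 Y y).le_of_opNorm_le_of_le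
      hy.le hg
  have h1 : ‖z F - g₀ y‖ ≤ r := by
    refine le_of_tendsto ((hU F).sub (hg₀ y)).norm (Filter.univ_mem' fun g => ?_)
    exact hb g (mem_closedBall_zero_iff.1 g.2)
  have h3 : (z - NormedSpace.inclusionInDoubleDual 𝕜 (StrongDual 𝕜 X) (dualOp T g₀)) F
      = (z F - g₀ y) - (F (dualOp T g₀) - g₀ y) := by
    simp
  rw [h3, two_mul]
  exact (norm_sub_le _ _).trans (add_le_add h1 (hb g₀ hg₀1))

theorem wkOp_comp_isometry_le {E : Type*} [NormedAddCommGroup E] [NormedSpace 𝕜 E]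
    (e : Y ≃ₗᵢ[𝕜] E) (T : X →L[𝕜] Y) :
    wkOp ((e : Y →L[𝕜] E).comp T) ≤ wkOp T := by
  rw [← one_mul (wkOp T)]
  refine le_mul_of_forall_real (C := 1) one_pos fun r hr hlt => ?_
  rw [ENNReal.coe_one, one_mul]
  refine wk_le_ofReal fun z hz => ?_
  obtain ⟨U, hU⟩ := (mem_wsClosure_image_iff _ _ z).1 hz
  have hz' : z.comp (dualOp (e.symm : E →L[𝕜] Y)) ∈ wsClosure 𝕜 (T '' Metric.closedBall 0 1) := by
    refine (mem_wsClosure_image_iff _ _ _).2 ⟨U, fun f => ?_⟩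
    have := hU (dualOp (e.symm : E →L[𝕜] Y) f)
    simpa [dualOp_apply] using this
  obtain ⟨y, hy⟩ := exists_norm_sub_lt_of_wk_lt hlt hz'
  refine ⟨e y, ContinuousLinearMap.opNorm_le_of_unit_norm hr.le fun g hg => ?_⟩
  have hge : ‖dualOp (e : Y →L[𝕜] E) g‖ ≤ 1 := by
    refine ContinuousLinearMap.opNorm_le_bound _ zero_le_one fun x => ?_
    simpa [dualOp_apply, hg] using g.le_opNorm (e x)
  have hgg : dualOp (e.symm : E →L[𝕜] Y) (dualOp (e : Y →L[𝕜] E) g) = g := by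
    ext x; simp [dualOp_apply]
  have h : ‖z (dualOp (e.symm : E →L[𝕜] Y) (dualOp (e : Y →L[𝕜] E) g)) - g (e y)‖ ≤ r :=
    (z.comp (dualOp (e.symm : E →L[𝕜] Y)) -
      NormedSpace.inclusionInDoubleDual 𝕜 Y y).le_of_opNorm_le_of_le hy.le hge |>.trans_eq
      (mul_one r)
  rwa [hgg] at h

theorem cc_le_cc_comp_isometry {E : Type*} [NormedAddCommGroup E] [NormedSpace 𝕜 E]
    (e : Y ≃ₗᵢ[𝕜] E) (T : X →L[𝕜] Y) : cc T ≤ cc ((e : Y →L[𝕜] E).comp T) := by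
  refine iSup_mono fun x => iSup_mono fun _ => iSup_mono fun _ => ?_
  refine iSup₂_le fun F hF => ?_
  change osc 𝕜 F _ ≤ _
  refine le_trans ?_ (osc_le_caFam (F := dualOp (e.symm : E →L[𝕜] Y) '' F) ?_ _)
  · refine iInf_mono fun N => iSup_mono fun m => iSup_mono fun _ => iSup_mono fun n =>
      iSup_mono fun _ => ?_
    refine iSup₂_le fun f hf => ?_
    refine le_iSup₂_of_le _ (mem_image_of_mem _ hf) ?_
    simp [dualOp_apply]
  · rintro _ ⟨f, hf, rfl⟩
    rw [mem_closedBall_zero_iff]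
    refine ContinuousLinearMap.opNorm_le_bound _ zero_le_one fun x => ?_
    have hf1 : ‖f‖ ≤ 1 := by simpa using hF hf
    simpa [dualOp_apply] using f.le_of_opNorm_le hf1 (e.symm x)

end Operators

/-! ### Operators into the space of bounded sequences -/

section BoundedSequences

variable {𝕜 : Type} [RCLike 𝕜]

theorem apply_lp_single (g : StrongDual 𝕜 (lp (fun _ : ℕ => 𝕜) ∞)) (n : ℕ) (c : 𝕜) :
    g (lp.single ∞ n c) = c * g (lp.single ∞ n 1) := by
  rw [← smul_eq_mul, ← map_smul, ← lp.single_smul, smul_eq_mul, mul_one]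

theorem sum_lp_single_apply (s : Finset ℕ) (c : ℕ → 𝕜) (i : ℕ) :
    (∑ n ∈ s, lp.single ∞ n (c n) : lp (fun _ : ℕ => 𝕜) ∞) i = if i ∈ s then c i else 0 := by
  rw [lp.coeFn_sum, Finset.sum_apply]
  simp only [lp.single_apply, Pi.single_apply]
  simp

theorem summable_norm_apply_single (g : StrongDual 𝕜 (lp (fun _ : ℕ => 𝕜) ∞)) :
    Summable fun n => ‖g (lp.single ∞ n 1)‖ := by
  choose c hc hcg using fun n => RCLike.exists_norm_eq_mul_self (g (lp.single ∞ n 1))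
  refine summable_of_sum_le (c := ‖g‖) (fun _ => norm_nonneg _) fun s => ?_
  have hnorm : ‖(∑ n ∈ s, lp.single ∞ n (c n) : lp (fun _ : ℕ => 𝕜) ∞)‖ ≤ 1 := by
    refine lp.norm_le_of_forall_le zero_le_one fun i => ?_
    rw [sum_lp_single_apply]
    split_ifs
    · exact (hc i).le
    · simp
  have hsum : g (∑ n ∈ s, lp.single ∞ n (c n)) = ((∑ n ∈ s, ‖g (lp.single ∞ n 1)‖ : ℝ) : 𝕜) := by
    rw [map_sum, RCLike.ofReal_sum]
    exact Finset.sum_congr rfl fun n _ => by rw [apply_lp_single, hcg]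
  have h := g.le_of_opNorm_le_of_le le_rfl hnorm
  rw [hsum, RCLike.norm_ofReal, mul_one] at h
  exact (le_abs_self _).trans h

/-- A functional on bounded sequences is, up to a small error, the sum of a finite combination of
coordinates and a functional vanishing on finitely supported sequences; the latter only sees the
limit superior of the sequence. The cut `N` is uniform over bounded sets of sequences `v`. -/
theorem norm_apply_sub_sum_le (g : StrongDual 𝕜 (lp (fun _ : ℕ => 𝕜) ∞)) {N : ℕ} {ε : ℝ}
    (hN : ∀ K, ∑ n ∈ Finset.Ico N K, ‖g (lp.single ∞ n 1)‖ ≤ ε) {v : lp (fun _ : ℕ => 𝕜) ∞}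
    {M s : ℝ} (hM : ‖v‖ ≤ M) (hs : 0 ≤ s) (hv : ∀ᶠ n in atTop, ‖v n‖ ≤ s) :
    ‖g v - ∑ n ∈ Finset.range N, v n * g (lp.single ∞ n 1)‖ ≤ s * ‖g‖ + M * ε := by
  -- Beyond `K` the entries of `v` are at most `s`; between `N` and `K` they are only known to be
  -- bounded by `M`.
  obtain ⟨K₀, hK₀⟩ := eventually_atTop.1 hv
  set K := max K₀ N
  have hM0 : 0 ≤ M := (norm_nonneg v).trans hM
  have hrest : ‖v - ∑ n ∈ Finset.range K, lp.single ∞ n (v n)‖ ≤ s := by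
    refine lp.norm_le_of_forall_le hs fun i => ?_
    rw [lp.coeFn_sub, Pi.sub_apply, sum_lp_single_apply]
    split_ifs with hi
    · simpa using hs
    · rw [sub_zero]
      exact hK₀ i ((le_max_left K₀ N).trans (not_lt.1 fun h => hi (Finset.mem_range.2 h)))
  have hsplit : g v - ∑ n ∈ Finset.range N, v n * g (lp.single ∞ n 1) =
      g (v - ∑ n ∈ Finset.range K, lp.single ∞ n (v n)) +
        ∑ n ∈ Finset.Ico N K, v n * g (lp.single ∞ n 1) := by
    rw [map_sub, map_sum, Finset.sum_congr rfl fun n _ => apply_lp_single g n (v n),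
      ← Finset.sum_range_add_sum_Ico _ (le_max_right K₀ N)]
    ring
  rw [hsplit]
  refine (norm_add_le _ _).trans (add_le_add ?_ ?_)
  · rw [mul_comm]
    exact g.le_of_opNorm_le_of_le le_rfl hrest
  · refine (norm_sum_le _ _).trans ?_
    calc ∑ n ∈ Finset.Ico N K, ‖v n * g (lp.single ∞ n 1)‖
        ≤ ∑ n ∈ Finset.Ico N K, M * ‖g (lp.single ∞ n 1)‖ := by
          refine Finset.sum_le_sum fun n _ => ?_
          rw [norm_mul]
          gcongr
          exact (lp.norm_apply_le_norm ENNReal.top_ne_zero v n).trans hM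
      _ ≤ M * ε := by
          rw [← Finset.mul_sum]
          exact mul_le_mul_of_nonneg_left (hN K) hM0

theorem exists_tail_sum_le (g : StrongDual 𝕜 (lp (fun _ : ℕ => 𝕜) ∞)) {ε : ℝ} (hε : 0 < ε) :
    ∃ N, ∀ K, ∑ n ∈ Finset.Ico N K, ‖g (lp.single ∞ n 1)‖ ≤ ε := by
  have hsum := summable_norm_apply_single g
  have ht := tendsto_sum_nat_add fun n => ‖g (lp.single ∞ n 1)‖
  obtain ⟨N, hN⟩ := (ht.eventually (ge_mem_nhds hε)).exists
  refine ⟨N, fun K => ?_⟩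
  rw [Finset.sum_Ico_eq_sum_range]
  refine le_trans ?_ hN
  simp only [add_comm N]
  exact ((summable_nat_add_iff N).2 hsum).sum_le_tsum _ fun _ _ => norm_nonneg _

variable {X : Type*} [NormedAddCommGroup X] [NormedSpace 𝕜 X]

theorem exists_operator_of_bounded {z : ℕ → StrongDual 𝕜 X} {M : ℝ} (hM : 0 ≤ M)
    (hz : ∀ n, ‖z n‖ ≤ M) :
    ∃ T : X →L[𝕜] lp (fun _ : ℕ => 𝕜) ∞, ∀ x n, T x n = z n x := by
  have hb : ∀ x n, ‖z n x‖ ≤ M * ‖x‖ := fun x n => (z n).le_of_opNorm_le (hz n) x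
  have hmem : ∀ x, Memℓp (fun n => z n x) ∞ := fun x =>
    memℓp_infty ⟨M * ‖x‖, by rintro _ ⟨n, rfl⟩; exact hb x n⟩
  let L : X →ₗ[𝕜] lp (fun _ : ℕ => 𝕜) ∞ :=
    { toFun := fun x => ⟨fun n => z n x, hmem x⟩
      map_add' := fun x y => by ext n; exact map_add (z n) x y
      map_smul' := fun c x => by ext n; exact map_smul (z n) c x }
  have hL : ∀ x, ‖L x‖ ≤ M * ‖x‖ := fun x =>
    lp.norm_le_of_forall_le (by positivity) fun n => hb x n
  exact ⟨L.mkContinuous M hL, fun _ _ => rfl⟩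

/-- If the coordinate functionals `z n` of `T` eventually satisfy `|F (z n)| ≤ s ‖F‖`, for every
`F ∈ X**`, then `T` is almost weakly compact. A weak* limit of `T x`, with `x` in the
unit ball, is close to the sequence `F (z n)`, where `F ∈ X**` is the weak* limit of the `x`. -/
theorem wkOp_le_of_eventually_le {z : ℕ → StrongDual 𝕜 X} {s : ℝ} (hs : 0 ≤ s)
    (hz : ∀ F : StrongDual 𝕜 (StrongDual 𝕜 X), ∀ᶠ n in atTop, ‖F (z n)‖ ≤ s * ‖F‖)
    {T : X →L[𝕜] lp (fun _ : ℕ => 𝕜) ∞} (hT : ∀ x n, T x n = z n x) :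
    wkOp T ≤ ENNReal.ofReal (2 * s) := by
  refine wk_le_ofReal fun Z hZ => ?_
  obtain ⟨U, hU⟩ := (mem_wsClosure_image_iff _ _ Z).1 hZ
  set M := ‖T‖
  have hTM : ∀ x : Metric.closedBall (0 : X) 1, ‖T x‖ ≤ M := fun x => by
    simpa using T.le_of_opNorm_le_of_le le_rfl (mem_closedBall_zero_iff.1 x.2)
  obtain ⟨F, hF1, hF⟩ := exists_dual_limit (𝕜 := 𝕜) U
    (fun x => NormedSpace.inclusionInDoubleDual 𝕜 X x) (M := 1) fun x =>
      (NormedSpace.double_dual_bound 𝕜 X _).trans (mem_closedBall_zero_iff.1 x.2)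
  have hFz : ∀ n, Tendsto (fun x : Metric.closedBall (0 : X) 1 => T x n) U (𝓝 (F (z n))) :=
    fun n => by simp only [hT]; exact hF (z n)
  have hFM : ∀ n, ‖F (z n)‖ ≤ M := fun n =>
    le_of_tendsto (hFz n).norm (Filter.univ_mem' fun x =>
      (lp.norm_apply_le_norm ENNReal.top_ne_zero (T x) n).trans (hTM x))
  let y : lp (fun _ : ℕ => 𝕜) ∞ :=
    ⟨fun n => F (z n), memℓp_infty ⟨M, by rintro _ ⟨n, rfl⟩; exact hFM n⟩⟩
  have hyM : ‖y‖ ≤ M := lp.norm_le_of_forall_le (norm_nonneg _) hFM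
  have hys : ∀ᶠ n in atTop, ‖y n‖ ≤ s := (hz F).mono fun n hn =>
    hn.trans (mul_le_of_le_one_right hs hF1)
  refine ⟨y, ContinuousLinearMap.opNorm_le_bound _ (by positivity) fun g => ?_⟩
  refine le_of_forall_pos_le_add fun ε hε => ?_
  have hδ : 0 < ε / (2 * (M + 1)) := by positivity
  obtain ⟨N, hN⟩ := exists_tail_sum_le g hδ
  set S := ∑ n ∈ Finset.range N, F (z n) * g (lp.single ∞ n 1)
  have h1 : ‖Z g - S‖ ≤ s * ‖g‖ + M * (ε / (2 * (M + 1))) := by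
    have hlim : Tendsto (fun x : Metric.closedBall (0 : X) 1 =>
        ‖g (T x) - ∑ n ∈ Finset.range N, T x n * g (lp.single ∞ n 1)‖) U (𝓝 ‖Z g - S‖) :=
      ((hU g).sub (tendsto_finsetSum _ fun n _ => (hFz n).mul_const _)).norm
    refine le_of_tendsto hlim (Filter.univ_mem' fun x => ?_)
    refine norm_apply_sub_sum_le g hN (hTM x) hs ?_
    refine (hz (NormedSpace.inclusionInDoubleDual 𝕜 X x)).mono fun n hn => ?_
    rw [hT]
    refine hn.trans (mul_le_of_le_one_right hs ?_)
    exact (NormedSpace.double_dual_bound 𝕜 X _).trans (mem_closedBall_zero_iff.1 x.2)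
  have h2 : ‖g y - S‖ ≤ s * ‖g‖ + M * (ε / (2 * (M + 1))) :=
    norm_apply_sub_sum_le g hN hyM hs hys
  have h3 : M * (ε / (2 * (M + 1))) ≤ ε / 2 := by
    have : M * (ε / (2 * (M + 1))) = (ε / 2) * (M / (M + 1)) := by field_simp
    rw [this]
    exact mul_le_of_le_one_right (by positivity)
      ((div_le_one (by positivity)).2 (by linarith))
  have h4 : (Z - NormedSpace.inclusionInDoubleDual 𝕜 _ y) g = (Z g - S) - (g y - S) := by
    simp
  rw [h4]
  refine (norm_sub_le _ _).trans ?_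
  linarith

end BoundedSequences

/-! ### The implications -/

section Implications

variable {𝕜 : Type} [RCLike 𝕜]
variable {X : Type u} [NormedAddCommGroup X] [NormedSpace 𝕜 X]
variable {Y : Type v} [NormedAddCommGroup Y] [NormedSpace 𝕜 Y]

theorem le_of_forall_ofReal_lt {a b : ℝ≥0∞}
    (h : ∀ c : ℝ, ENNReal.ofReal c < a → ENNReal.ofReal c ≤ b) : a ≤ b := by
  refine le_of_forall_lt_imp_le_of_dense fun c hc => ?_
  have hct := ENNReal.ofReal_toReal (ne_top_of_lt hc)
  simpa only [hct] using h c.toReal (by rwa [hct])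

/-- Weak* cluster points of a sequence which are not terms of it have small norm when the sequence
is eventually small at every functional. -/
theorem wk_range_le_of_eventually_le {w : ℕ → X} {s : ℝ} (hs : 0 ≤ s)
    (h : ∀ f : StrongDual 𝕜 X, ‖f‖ = 1 → ∀ᶠ n in atTop, ‖f (w n)‖ ≤ s) :
    wk 𝕜 (range w) ≤ ENNReal.ofReal s := by
  refine wk_le_ofReal fun z hz => ?_
  obtain ⟨U, hU⟩ := (mem_wsClosure_range_iff _ z).1 hz
  -- A principal ultrafilter gives a term of the sequence, which already lies in the space.
  rcases U.le_cofinite_or_eq_pure with hcof | ⟨n, hn⟩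
  · refine ⟨0, ContinuousLinearMap.opNorm_le_of_unit_norm hs fun f hf => ?_⟩
    have hev : ∀ᶠ n in (U : Filter ℕ), ‖f (w n)‖ ≤ s :=
      (h f hf).filter_mono (hcof.trans Nat.cofinite_eq_atTop.le)
    simpa using le_of_tendsto (hU f).norm hev
  · refine ⟨w n, ContinuousLinearMap.opNorm_le_of_unit_norm hs fun f _ => ?_⟩
    have : z f = f (w n) := by
      refine tendsto_nhds_unique (hU f) ?_
      rw [hn]
      exact tendsto_pure_nhds (fun n => f (w n)) n
    simp [this, hs]

variable (𝕜 X) in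
/-- The sequential Dunford–Pettis property with constant `C`: weakly null sequences in the unit ball
of `X` pair with bounded sequences in `X*` to give a limit superior of at most `C` times the measure
of weak non-compactness of the latter. -/
def LimsupBound (C : ℝ≥0) : Prop :=
  ∀ (x : ℕ → X) (x' : ℕ → StrongDual 𝕜 X), (∀ n, x n ∈ Metric.closedBall (0 : X) 1) →
    WeaklyNull 𝕜 x → Bornology.IsBounded (Set.range x') →
      limsup (fun n => ‖x' n (x n)‖ₑ) atTop ≤ C * wk 𝕜 (Set.range x')

/-- The bound for weakly null sequences in the ball of radius `2`, which is where differences of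
elements of the unit ball lie. -/
theorem LimsupBound.ofReal_le {C : ℝ≥0} (h : LimsupBound 𝕜 X C) {x : ℕ → X}
    {x' : ℕ → StrongDual 𝕜 X} (hx : ∀ n, ‖x n‖ ≤ 2) (hx0 : WeaklyNull 𝕜 x)
    (hx' : Bornology.IsBounded (range x')) {c : ℝ} (hc : ∃ᶠ n in atTop, c ≤ ‖x' n (x n)‖) :
    ENNReal.ofReal c ≤ 2 * C * wk 𝕜 (range x') := by
  have h2 : ‖(2⁻¹ : 𝕜)‖ = 2⁻¹ := by simp
  have h1 := h (fun n => (2⁻¹ : 𝕜) • x n) x' (fun n => by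
      rw [mem_closedBall_zero_iff, norm_smul, h2]
      linarith [hx n]) (weaklyNull_iff.2 fun f => by
        simpa using ((weaklyNull_iff.1 hx0 f).const_mul (2⁻¹ : 𝕜))) hx'
  have h3 : ENNReal.ofReal (2⁻¹ * c) ≤ limsup (fun n => ‖x' n ((2⁻¹ : 𝕜) • x n)‖ₑ) atTop := by
    refine le_limsup_of_frequently_le' (hc.mono fun n hn => ?_)
    rw [← ofReal_norm, map_smul, norm_smul, h2]
    exact ENNReal.ofReal_le_ofReal (by linarith)
  calc ENNReal.ofReal c = 2 * ENNReal.ofReal (2⁻¹ * c) := by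
        rw [← ENNReal.ofReal_ofNat, ← ENNReal.ofReal_mul (by norm_num)]
        congr 1; ring
    _ ≤ 2 * (C * wk 𝕜 (range x')) := by gcongr; exact h3.trans h1
    _ = 2 * C * wk 𝕜 (range x') := by ring

/-- Differences `x (m k) - x (n k)` on which `T` stays large are weakly null, and functionals `f k`
norming their images give the sequence `T* (f k)` in `X*`. -/
theorem LimsupBound.cc_le {C : ℝ≥0} (h : LimsupBound 𝕜 X C) (T : X →L[𝕜] Y) :
    cc T ≤ (2 * C : ℝ≥0) * wkOp (dualOp T) := by
  refine iSup_le fun x => iSup₂_le fun hx hxc => iSup₂_le fun F hF => ?_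
  refine le_of_forall_ofReal_lt fun c hc => ?_
  choose m hm n hn f hf hlt using exists_of_lt_osc (F := F) (x := fun n => T (x n)) hc
  have hf1 : ∀ k, ‖f k‖ ≤ 1 := fun k => mem_closedBall_zero_iff.1 (hF (hf k))
  have hx1 : ∀ k, ‖x k‖ ≤ 1 := fun k => mem_closedBall_zero_iff.1 (hx k)
  have hm' := tendsto_atTop_mono hm tendsto_id
  have hn' := tendsto_atTop_mono hn tendsto_id
  have hsub : range (fun k => dualOp T (f k)) ⊆ dualOp T '' Metric.closedBall 0 1 := by
    rintro _ ⟨k, rfl⟩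
    exact mem_image_of_mem _ (hF (hf k))
  have key := h.ofReal_le (x := fun k => x (m k) - x (n k)) (x' := fun k => dualOp T (f k))
    (fun k => (norm_sub_le _ _).trans (by linarith [hx1 (m k), hx1 (n k)]))
    (weaklyNull_iff.2 fun g => by
      obtain ⟨l, hl⟩ := cauchySeq_tendsto_of_complete (hxc g)
      simpa using (hl.comp hm').sub (hl.comp hn'))
    (isBounded_iff_forall_norm_le.2 ⟨‖dualOp T‖, by
      rintro _ ⟨k, rfl⟩
      simpa using (dualOp T).le_of_opNorm_le_of_le le_rfl (hf1 k)⟩)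
    (Frequently.of_forall fun k => by
      rw [dualOp_apply, map_sub]
      exact (hlt k).le)
  refine key.trans ?_
  rw [ENNReal.coe_mul]
  exact mul_le_mul_right (wk_mono hsub) _

/-- Points of a weakly compact set witnessing the oscillation of `x'` have a weakly convergent
subsequence. Subtracting its limit costs at most `deltaSeq 𝕜 x'`, which also bounds the measure of
weak non-compactness of the differences `x' (m k) - x' (n k)`. -/
theorem LimsupBound.caRhoStar_le {C : ℝ≥0} (h : LimsupBound 𝕜 X C) {x' : ℕ → StrongDual 𝕜 X}
    (hx' : Bornology.IsBounded (range x')) :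
    caRhoStar 𝕜 x' ≤ (2 * C + 1 : ℝ≥0) * deltaSeq 𝕜 x' := by
  refine le_mul_of_forall_real (by positivity) fun r hr hlt => ?_
  have hδ : ∀ f : StrongDual 𝕜 (StrongDual 𝕜 X), ‖f‖ ≤ 1 →
      ∃ N, ∀ m ≥ N, ∀ n ≥ N, ‖f (x' m - x' n)‖ < r := fun f hf => by
    obtain ⟨N, hN⟩ := exists_forall_of_osc_lt ((osc_le_caFam (𝓕 := weakFamily 𝕜 _)
      (F := {f}) ⟨singleton_subset_iff.2 (mem_closedBall_zero_iff.2 hf), finite_singleton f⟩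
      x').trans_lt hlt)
    exact ⟨N, fun m hm n hn => hN m hm n hn f rfl⟩
  obtain ⟨M, hM⟩ := isBounded_iff_forall_norm_le.1 hx'
  refine iSup₂_le fun F hF => ?_
  obtain ⟨K, hK1, hK, rfl⟩ := hF
  refine le_of_forall_ofReal_lt fun c hc => ?_
  have hosc := exists_of_lt_osc (x := x') hc
  simp only [mem_image, exists_exists_and_eq_and, NormedSpace.dual_def] at hosc
  choose m hm n hn x hxK hlt' using hosc
  have hK1' : ∀ x ∈ K, ‖x‖ ≤ 1 := fun x hx => mem_closedBall_zero_iff.1 (hK1 hx)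
  obtain ⟨φ, hφ, u, hu, hlim⟩ := hK.exists_subseq hK1' hxK
  have hu1 := hK1' u hu
  have hm' : ∀ k, k ≤ m (φ k) := fun k => hφ.le_apply.trans (hm _)
  have hn' : ∀ k, k ≤ n (φ k) := fun k => hφ.le_apply.trans (hn _)
  have hwk : wk 𝕜 (range fun k => x' (m (φ k)) - x' (n (φ k))) ≤ ENNReal.ofReal r := by
    refine wk_range_le_of_eventually_le hr.le fun f hf => ?_
    obtain ⟨N, hN⟩ := hδ f hf.le
    exact eventually_atTop.2 ⟨N, fun k hk =>
      (hN _ (le_trans hk (hm' k)) _ (le_trans hk (hn' k))).le⟩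
  have key := h.ofReal_le (x := fun k => x (φ k) - u)
    (x' := fun k => x' (m (φ k)) - x' (n (φ k))) (c := c - r)
    (fun k => (norm_sub_le _ _).trans (by linarith [hK1' _ (hxK (φ k))]))
    (weaklyNull_iff.2 fun f => by simpa using (hlim f).sub_const (f u))
    (isBounded_iff_forall_norm_le.2 ⟨M + M, by
      rintro _ ⟨k, rfl⟩
      exact (norm_sub_le _ _).trans (add_le_add (hM _ ⟨_, rfl⟩) (hM _ ⟨_, rfl⟩))⟩)
    (Eventually.frequently (by
      obtain ⟨N, hN⟩ := hδ (NormedSpace.inclusionInDoubleDual 𝕜 X u)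
        ((NormedSpace.double_dual_bound 𝕜 X u).trans hu1)
      refine eventually_atTop.2 ⟨N, fun k hk => ?_⟩
      have h1 := hN _ (le_trans hk (hm' k)) _ (le_trans hk (hn' k))
      rw [NormedSpace.dual_def] at h1
      have h2 := hlt' (φ k)
      rw [map_sub]
      have h3 := norm_sub_norm_le ((x' (m (φ k)) - x' (n (φ k))) (x (φ k)))
        ((x' (m (φ k)) - x' (n (φ k))) u)
      linarith))
  have hfin : ENNReal.ofReal (c - r) ≤ ENNReal.ofReal (2 * C * r) := by
    refine key.trans ((mul_le_mul_right hwk _).trans_eq ?_)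
    rw [ENNReal.ofReal_mul (by positivity), ENNReal.ofReal_mul two_pos.le]
    simp
  have hfin' : c - r ≤ 2 * C * r := by
    by_contra hcon
    rw [not_le] at hcon
    exact hfin.not_gt ((ENNReal.ofReal_lt_ofReal_iff_of_nonneg (by positivity)).2 hcon)
  calc ENNReal.ofReal c ≤ ENNReal.ofReal ((2 * C + 1 : ℝ≥0) * r) :=
        ENNReal.ofReal_le_ofReal (by push_cast; linarith)
    _ = _ := by rw [ENNReal.ofReal_mul (by positivity), ENNReal.ofReal_coe_nnreal]

theorem wcaRhoStar_le_of_caRhoStar_le {C : ℝ≥0} (hC : 0 < C)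
    (h : ∀ x' : ℕ → StrongDual 𝕜 X, Bornology.IsBounded (range x') →
      caRhoStar 𝕜 x' ≤ C * deltaSeq 𝕜 x') {x' : ℕ → StrongDual 𝕜 X}
    (hx' : Bornology.IsBounded (range x')) :
    wcaRhoStar 𝕜 x' ≤ (C * 18 : ℝ≥0) * wk 𝕜 (range x') := by
  refine le_mul_of_forall_real (by positivity) fun r hr hlt => ?_
  obtain ⟨M, hM⟩ := isBounded_iff_forall_norm_le.1 hx'
  obtain ⟨φ, hφ, u, hu⟩ := exists_subseq_eventually_near (fun n => hM _ (mem_range_self n)) hr hlt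
  refine (iInf₂_le φ hφ).trans ((h _ (hx'.subset (range_comp_subset_range φ x'))).trans ?_)
  have hδ : deltaSeq 𝕜 (x' ∘ φ) ≤ ENNReal.ofReal (18 * r) := by
    refine iSup₂_le fun F hF => osc_le ?_
    have hev : ∀ᶠ n in atTop, ∀ f ∈ F, ‖f (x' (φ n) - u)‖ ≤ 9 * r * ‖f‖ :=
      hF.2.eventually_all.2 fun f _ => hu f
    obtain ⟨N, hN⟩ := eventually_atTop.1 hev
    refine ⟨N, fun m hm n hn f hf => ?_⟩
    have hf1 : ‖f‖ ≤ 1 := mem_closedBall_zero_iff.1 (hF.1 hf)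
    have e : f ((x' ∘ φ) m - (x' ∘ φ) n) = f (x' (φ m) - u) - f (x' (φ n) - u) := by
      rw [← map_sub]; simp
    rw [e]
    have h1 := hN m hm f hf
    have h2 := hN n hn f hf
    refine (norm_sub_le _ _).trans ?_
    nlinarith
  refine (mul_le_mul_right hδ _).trans_eq ?_
  rw [ENNReal.ofReal_mul (by norm_num), ENNReal.coe_mul, mul_assoc]
  simp

theorem exists_subseq_of_lt_limsup {x : ℕ → X} {x' : ℕ → StrongDual 𝕜 X} {c : ℝ}
    (h : ENNReal.ofReal c < limsup (fun n => ‖x' n (x n)‖ₑ) atTop) :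
    ∃ ψ : ℕ → ℕ, StrictMono ψ ∧ ∀ n, c < ‖x' (ψ n) (x (ψ n))‖ := by
  have hfr : ∃ᶠ n in atTop, c < ‖x' n (x n)‖ := by
    refine (frequently_lt_of_lt_limsup (by isBoundedDefault) h).mono fun n hn => ?_
    rw [← ofReal_norm] at hn
    exact lt_of_not_ge fun hle => hn.not_ge (ENNReal.ofReal_le_ofReal hle)
  exact extraction_of_frequently_atTop hfr

/-- A weakly null sequence together with `0` is a weakly compact set, on which a subsequence of the
functionals is almost uniformly Cauchy. -/
theorem limsupBound_of_wcaRhoStar_le {C : ℝ≥0}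
    (h : ∀ x' : ℕ → StrongDual 𝕜 X, Bornology.IsBounded (range x') →
      wcaRhoStar 𝕜 x' ≤ C * wk 𝕜 (range x')) :
    LimsupBound 𝕜 X (C + 2) := by
  intro x x' hx hx0 hx'
  refine le_mul_of_forall_real (by positivity) fun r hr hlt => ?_
  rw [← ENNReal.ofReal_coe_nnreal, ← ENNReal.ofReal_mul (by positivity)]
  by_contra! hcon
  obtain ⟨ψ, hψ, hψlt⟩ := exists_subseq_of_lt_limsup hcon
  push_cast at hψlt
  have hsub := range_comp_subset_range ψ x'
  have hw : wcaRhoStar 𝕜 (x' ∘ ψ) < ENNReal.ofReal ((C + 1) * r) := by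
    refine (h _ (hx'.subset hsub)).trans_lt ?_
    calc C * wk 𝕜 (range (x' ∘ ψ)) ≤ C * ENNReal.ofReal r := by
          gcongr; exact (wk_mono hsub).trans hlt.le
      _ = ENNReal.ofReal (C * r) := by
          rw [ENNReal.ofReal_mul (by positivity), ENNReal.ofReal_coe_nnreal]
      _ < _ := (ENNReal.ofReal_lt_ofReal_iff_of_nonneg (by positivity)).2 (by linarith)
  simp only [wcaRhoStar, iInf_lt_iff] at hw
  obtain ⟨φ, hφ, hφlt⟩ := hw
  have hK : IsWeaklyCompact 𝕜 (insert 0 (range x)) := by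
    have := Tendsto.isCompact_insert_range hx0
    rw [IsWeaklyCompact, image_insert_eq, map_zero, ← range_comp]
    exact this
  have hKmem : NormedSpace.inclusionInDoubleDual 𝕜 X '' insert 0 (range x) ∈ rhoStarFamily 𝕜 X :=
    ⟨_, insert_subset (by simp) (range_subset_iff.2 hx), hK, rfl⟩
  obtain ⟨N, hN⟩ := exists_forall_of_osc_lt ((osc_le_caFam hKmem _).trans_lt hφlt)
  have hlim : Tendsto (fun n => ‖x' (ψ (φ N)) (x (ψ (φ n)))‖) atTop (𝓝 0) := by
    simpa using ((weaklyNull_iff.1 hx0 (x' (ψ (φ N)))).comp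
      (hψ.comp hφ).tendsto_atTop).norm
  obtain ⟨n, hn1, hn2⟩ := ((hlim.eventually (gt_mem_nhds hr)).and (eventually_ge_atTop N)).exists
  have h1 := hN n hn2 N le_rfl (NormedSpace.inclusionInDoubleDual 𝕜 X (x (ψ (φ n))))
    (mem_image_of_mem _ (mem_insert_of_mem _ (mem_range_self _)))
  rw [NormedSpace.dual_def] at h1
  have h2 := norm_sub_norm_le (x' (ψ (φ n)) (x (ψ (φ n)))) (x' (ψ (φ N)) (x (ψ (φ n))))
  have h3 := hψlt (φ n)
  change ‖x' (ψ (φ n)) (x (ψ (φ n))) - x' (ψ (φ N)) (x (ψ (φ n)))‖ < _ at h1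
  nlinarith

/-- The hypothesis is applied to the operator whose coordinates are `x' n - u`, where the `x'` have
been thinned out so as to be weakly close to `u`. This makes the operator almost weakly compact
without passing to the convex hull of the `x'`. -/
theorem limsupBound_of_cc_le_wkOp {C : ℝ≥0}
    (h : ∀ T : X →L[𝕜] lp (fun _ : ℕ => 𝕜) ∞, cc T ≤ C * wkOp T) :
    LimsupBound 𝕜 X (18 * C + 3) := by
  intro x x' hx hx0 hx'
  refine le_mul_of_forall_real (by positivity) fun r hr hlt => ?_
  rw [← ENNReal.ofReal_coe_nnreal, ← ENNReal.ofReal_mul (by positivity)]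
  by_contra! hcon
  obtain ⟨ψ, hψ, hψlt⟩ := exists_subseq_of_lt_limsup hcon
  push_cast at hψlt
  obtain ⟨M, hM⟩ := isBounded_iff_forall_norm_le.1 hx'
  obtain ⟨φ, hφ, u, hu⟩ := exists_subseq_eventually_near (w := x' ∘ ψ)
    (fun n => hM _ ⟨ψ n, rfl⟩) hr ((wk_mono (range_comp_subset_range ψ x')).trans_lt hlt)
  have hψφ : Tendsto (fun n => ψ (φ n)) atTop atTop := (hψ.comp hφ).tendsto_atTop
  obtain ⟨T, hT⟩ := exists_operator_of_bounded (z := fun n => x' (ψ (φ n)) - u)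
    (M := M + ‖u‖) (add_nonneg ((norm_nonneg _).trans (hM _ ⟨0, rfl⟩)) (norm_nonneg u))
    (fun n => (norm_sub_le _ _).trans (add_le_add_left (hM _ ⟨_, rfl⟩) _))
  have hwk := wkOp_le_of_eventually_le (by positivity : 0 ≤ 9 * r) hu hT
  have hnull : ∀ f : StrongDual 𝕜 X, Tendsto (fun n => f (x (ψ (φ n)))) atTop (𝓝 0) :=
    fun f => (weaklyNull_iff.1 hx0 f).comp hψφ
  have hlow : ENNReal.ofReal ((18 * C + 1) * r) ≤ cc T := by
    refine le_iSup_of_le (fun n => x (ψ (φ n))) (le_iSup₂_of_le (fun n => hx _)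
      (fun f => (hnull f).cauchySeq) ?_)
    refine (le_osc fun N => ?_).trans (osc_le_caFam (F := Metric.closedBall 0 1)
      (Subset.refl _) _)
    have hsmall := ((hnull u).norm.eventually (gt_mem_nhds (by simpa using hr))).and
      (eventually_ge_atTop N)
    obtain ⟨n, hn1, hnN⟩ := hsmall.exists
    have hsmall' := (((hnull (x' (ψ (φ n)) - u)).norm.eventually
      (gt_mem_nhds (by simpa using hr))).and (eventually_ge_atTop N))
    obtain ⟨m, hm1, hmN⟩ := hsmall'.exists
    refine ⟨n, hnN, m, hmN, lp.evalCLM 𝕜 (fun _ : ℕ => 𝕜) ∞ n, ?_, ?_⟩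
    · rw [mem_closedBall_zero_iff]
      exact ContinuousLinearMap.opNorm_le_bound _ zero_le_one fun v => by
        rw [one_mul]
        exact lp.norm_apply_le_norm ENNReal.top_ne_zero v n
    · change _ ≤ ‖T (x (ψ (φ n))) n - T (x (ψ (φ m))) n‖
      rw [hT, hT]
      have h1 := hψlt (φ n)
      have h2 := norm_sub_norm_le ((x' (ψ (φ n)) - u) (x (ψ (φ n))))
        ((x' (ψ (φ n)) - u) (x (ψ (φ m))))
      have h3 := norm_sub_norm_le (x' (ψ (φ n)) (x (ψ (φ n)))) (u (x (ψ (φ n))))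
      have h4 : (x' (ψ (φ n)) - u) (x (ψ (φ n))) =
        x' (ψ (φ n)) (x (ψ (φ n))) - u (x (ψ (φ n))) := rfl
      rw [← h4] at h3
      nlinarith
  -- The defect `2 * (9 * r)` of `T` gives the `18 * C`; the summand `3` leaves room for the terms
  -- at `u` and at the index `m`.
  have hup : cc T ≤ ENNReal.ofReal (18 * C * r) := by
    refine (h T).trans ((mul_le_mul_right hwk _).trans_eq ?_)
    rw [← ENNReal.ofReal_coe_nnreal, ← ENNReal.ofReal_mul (by positivity)]
    congr 1; ring
  refine (hlow.trans hup).not_gt ((ENNReal.ofReal_lt_ofReal_iff_of_nonneg (by positivity)).2 ?_)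
  linarith

end Implications
end QuantDP

theorem theorem4p4 {𝕜 : Type} [RCLike 𝕜]
    (X : Type u) [NormedAddCommGroup X] [NormedSpace 𝕜 X] [CompleteSpace X] :
    List.TFAE [
      ∃ C : ℝ≥0, 0 < C ∧
        ∀ (Y : Type v) [NormedAddCommGroup Y] [NormedSpace 𝕜 Y] [CompleteSpace Y]
          (T : X →L[𝕜] Y), QuantDP.cc T ≤ C * QuantDP.wkOp (QuantDP.dualOp T),
      ∃ C : ℝ≥0, 0 < C ∧
        ∀ T : X →L[𝕜] lp (fun _ : ℕ => 𝕜) ∞,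
          QuantDP.cc T ≤ C * QuantDP.wkOp (QuantDP.dualOp T),
      ∃ C : ℝ≥0, 0 < C ∧
        ∀ (x : ℕ → X) (x' : ℕ → StrongDual 𝕜 X),
          (∀ n, x n ∈ Metric.closedBall (0 : X) 1) → QuantDP.WeaklyNull 𝕜 x →
          Bornology.IsBounded (Set.range x') →
          Filter.limsup (fun n => ‖x' n (x n)‖ₑ) Filter.atTop
            ≤ C * QuantDP.wk 𝕜 (Set.range x'),
      ∃ C : ℝ≥0, 0 < C ∧
        ∀ x' : ℕ → StrongDual 𝕜 X, Bornology.IsBounded (Set.range x') →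
          QuantDP.caRhoStar 𝕜 x' ≤ C * QuantDP.deltaSeq 𝕜 x',
      ∃ C : ℝ≥0, 0 < C ∧
        ∀ x' : ℕ → StrongDual 𝕜 X, Bornology.IsBounded (Set.range x') →
          QuantDP.wcaRhoStar 𝕜 x' ≤ C * QuantDP.wk 𝕜 (Set.range x'),
      ∃ C : ℝ≥0, 0 < C ∧
        ∀ (Y : Type v) [NormedAddCommGroup Y] [NormedSpace 𝕜 Y] [CompleteSpace Y]
          (T : X →L[𝕜] Y), QuantDP.cc T ≤ C * QuantDP.wkOp T,
      ∃ C : ℝ≥0, 0 < C ∧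
        ∀ T : X →L[𝕜] lp (fun _ : ℕ => 𝕜) ∞, QuantDP.cc T ≤ C * QuantDP.wkOp T] := by
  -- Replaces `b`, the measure for the adjoint, by the measure `c` for the operator.
  have of_adjoint : ∀ {C : ℝ≥0} {a b c : ℝ≥0∞}, a ≤ C * b → b ≤ 2 * c → a ≤ (C * 2 : ℝ≥0) * c :=
    fun {C a b c} hab hbc => hab.trans ((mul_le_mul_right hbc _).trans_eq
      (by rw [ENNReal.coe_mul, mul_assoc]; simp))
  tfae_have 3 → 1 := fun ⟨C, hC, h⟩ =>
    ⟨2 * C, by positivity, fun Y _ _ _ T => QuantDP.LimsupBound.cc_le h T⟩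
  tfae_have 3 → 2 := fun ⟨C, hC, h⟩ =>
    ⟨2 * C, by positivity, fun T => QuantDP.LimsupBound.cc_le h T⟩
  tfae_have 3 → 4 := fun ⟨C, hC, h⟩ =>
    ⟨2 * C + 1, by positivity, fun x' hx' => QuantDP.LimsupBound.caRhoStar_le h hx'⟩
  tfae_have 4 → 5 := fun ⟨C, hC, h⟩ =>
    ⟨C * 18, by positivity, fun x' hx' => QuantDP.wcaRhoStar_le_of_caRhoStar_le hC h hx'⟩
  tfae_have 5 → 3 := fun ⟨C, hC, h⟩ =>
    ⟨C + 2, by positivity, QuantDP.limsupBound_of_wcaRhoStar_le h⟩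
  tfae_have 1 → 6 := fun ⟨C, hC, h⟩ =>
    ⟨C * 2, by positivity, fun Y _ _ _ T => of_adjoint (h Y T) (QuantDP.wkOp_dualOp_le T)⟩
  tfae_have 2 → 7 := fun ⟨C, hC, h⟩ =>
    ⟨C * 2, by positivity, fun T => of_adjoint (h T) (QuantDP.wkOp_dualOp_le T)⟩
  tfae_have 6 → 7 := fun ⟨C, hC, h⟩ => ⟨C, hC, fun T => by
    let e : lp (fun _ : ℕ => 𝕜) ∞ ≃ₗᵢ[𝕜] ULift.{v} (lp (fun _ : ℕ => 𝕜) ∞) :=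
      { ULift.moduleEquiv.symm with norm_map' := fun _ => rfl }
    have : CompleteSpace (ULift.{v} (lp (fun _ : ℕ => 𝕜) ∞)) :=
      e.toIsometryEquiv.completeSpace_iff.1 inferInstance
    exact (QuantDP.cc_le_cc_comp_isometry e T).trans ((h _ _).trans
      (mul_le_mul_right (QuantDP.wkOp_comp_isometry_le e T) _))⟩
  tfae_have 7 → 3 := fun ⟨C, hC, h⟩ =>
    ⟨18 * C + 3, by positivity, QuantDP.limsupBound_of_cc_le_wkOp h⟩
  tfae_finish
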